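/- Let $k$ be an algebraically closed field of characteristic $0$ and let $(A,\mathfrak m)$ be an artinian Gorenstein local $k$-algebra. For an ideal $\mathfrak a$ of $A$ let $\mu(\mathfrak a)$ denote its minimal number of generators, and let $\ell(-)$ denote length. Suppose that $A$ is almost stretched, i.e. $\mu(\mathfrak m^2)=2$. Then $A$ is exact, i.e. $$\sup\{\mu(\mathfrak a) : \mathfrak a\subseteq \mathfrak m \text{ an ideal of } A\}=\inf\{\ell(A/xA) : x\in\mathfrak m\}.$$ -/

import Mathlib

universe u

/-- `μ(I)`: the minimal number of generators of an ideal, with value `⊤` if the ideal is not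
finitely generated. -/
noncomputable def Ideal.minGen {R : Type u} [CommRing R] (I : Ideal R) : ℕ∞ :=
  Cardinal.toENat (Submodule.spanRank I)

/-- The Dilworth number of a local ring `(R, 𝔪)`: the supremum of `μ(𝔞)` over the ideals
`𝔞 ⊆ 𝔪`. -/
noncomputable def dilworthNumber (R : Type u) [CommRing R] [IsLocalRing R] : ℕ∞ :=
  ⨆ I ∈ {I : Ideal R | I ≤ IsLocalRing.maximalIdeal R}, I.minGen

/-- The Rees number of a local ring `(R, 𝔪)`: the infimum of the lengths `ℓ(R / xR)` over
`x ∈ 𝔪`. -/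
noncomputable def reesNumber (R : Type u) [CommRing R] [IsLocalRing R] : ℕ∞ :=
  ⨅ x ∈ IsLocalRing.maximalIdeal R, Module.length R (R ⧸ Ideal.span {x})

/-- A local ring (noetherian, of Krull dimension at most one) is exact if its Dilworth number
equals its Rees number. -/
def IsExactLocalRing (R : Type u) [CommRing R] [IsLocalRing R] : Prop :=
  dilworthNumber R = reesNumber R

/-- A noetherian local ring is Gorenstein if it has finite injective dimension as a module over
itself. -/
def IsGorensteinLocalRing (R : Type u) [CommRing R] [IsLocalRing R] : Prop :=
  IsNoetherianRing R ∧
    ∃ n : ℕ, CategoryTheory.HasInjectiveDimensionLE (ModuleCat.of R R) n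

/-- An artinian local ring `(R, 𝔪)` is almost stretched if `μ(𝔪²) = 2`. -/
def IsAlmostStretched (R : Type u) [CommRing R] [IsLocalRing R] : Prop :=
  IsArtinianRing R ∧ (IsLocalRing.maximalIdeal R ^ 2).minGen = 2

/-!
For `x ∈ 𝔪` multiplication by `x` maps an ideal `I` into `𝔪I`, with kernel inside `(0 : x)`, and
`ℓ(0 : x) = ℓ(A / xA)`; hence `μ(I) = ℓ(I) - ℓ(𝔪I) ≤ ℓ(A / xA)`. So it is enough to find a single
`w ∈ 𝔪` with `ℓ(A / wA) = μ(𝔪)`. Any `w ≠ 0` with `𝔪² = w𝔪` will do, since then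
`ℓ(wA) = 1 + ℓ(𝔪²)`.

Such a `w` is obtained as in the Eakin–Sathaye theorem. By Nakayama's lemma two generators of `𝔪²`
can be chosen to be products `xy` and `uv` of elements of `𝔪`. If `x𝔪`, `y𝔪`, `u𝔪` and `v𝔪` are all
different from `𝔪²`, then, modulo `𝔪³`, each is the line through the generator it contains. The
product `xv` lies on both lines, and so does `uy`, so both vanish modulo `𝔪³`; therefore
`(x + u)y ≡ xy` and `(x + u)v ≡ uv`, and `𝔪² = (x + u)𝔪`. If `w = 0`, then `𝔪² = 0` and any
nonzero element of `𝔪` can take its place.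
-/

open IsLocalRing Module

section Length

variable {R M N : Type*} [Ring R] [AddCommGroup M] [AddCommGroup N] [Module R M] [Module R N]

theorem length_eq_length_add_length_quotient (P : Submodule R M) :
    length R M = length R P + length R (M ⧸ P) :=
  length_eq_add_of_exact P.subtype P.mkQ P.subtype_injective P.mkQ_surjective
    (LinearMap.exact_subtype_mkQ P)

theorem length_eq_length_ker_add_length_range (f : M →ₗ[R] N) :
    length R M = length R f.ker + length R f.range :=
  length_eq_add_of_exact f.ker.subtype f.rangeRestrict f.ker.subtype_injective
    f.surjective_rangeRestrict
    (by rw [LinearMap.exact_iff, LinearMap.ker_rangeRestrict, Submodule.range_subtype])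

theorem length_quotient_range_eq_length_ker [IsArtinian R M] [IsNoetherian R M]
    (f : M →ₗ[R] M) : length R (M ⧸ f.range) = length R f.ker := by
  have h := length_eq_length_add_length_quotient f.range
  rw [length_eq_length_ker_add_length_range f, add_comm] at h
  exact (ENat.add_right_injective_of_ne_top length_ne_top h).symm

theorem length_le_length_quotient_range_add_length_map [IsArtinian R M] [IsNoetherian R M]
    (f : M →ₗ[R] M) (P : Submodule R M) :
    length R P ≤ length R (M ⧸ f.range) + length R (P.map f) := by
  have hker : length R (f.domRestrict P).ker ≤ length R f.ker :=
    length_le_of_injective (P.subtype.restrict fun _ hx ↦ hx)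
      fun _ _ h ↦ Subtype.ext (Subtype.ext (congrArg (fun z ↦ (z.1 : M)) h))
  rw [length_quotient_range_eq_length_ker, length_eq_length_ker_add_length_range (f.domRestrict P),
    LinearMap.range_domRestrict]
  gcongr

end Length

theorem exists_span_range_fin_eq_of_spanRank_le {R M : Type*} [Semiring R] [AddCommMonoid M]
    [Module R M] {N : Submodule R M} {n : ℕ} (hN : N.spanRank ≤ n) :
    ∃ f : Fin n → M, Submodule.span R (Set.range f) = N := by
  obtain ⟨s, hs, rfl⟩ := N.exists_span_set_card_eq_spanRank
  obtain ⟨e⟩ : Nonempty (s ↪ Fin n) := Cardinal.lift_mk_le'.mp (by simpa [hs] using hN)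
  refine ⟨Function.extend e (↑) 0, le_antisymm ?_ ?_⟩
  · rw [Submodule.span_le, Set.range_extend e.injective, Subtype.range_coe]
    rintro _ (hx | ⟨_, -, rfl⟩)
    · exact Submodule.subset_span hx
    · exact zero_mem _
  · exact Submodule.span_mono fun x hx ↦ ⟨e ⟨x, hx⟩, e.injective.extend_apply _ _ ⟨x, hx⟩⟩

section LocalRing

variable {R M : Type*} [CommRing R] [IsLocalRing R] [AddCommGroup M] [Module R M]

theorem toENat_spanRank_add_length_maximalIdeal_smul {N : Submodule R M} (hN : N.FG) :
    N.spanRank.toENat + length R ↥(maximalIdeal R • N) = length R N := by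
  let : Field (R ⧸ maximalIdeal R) := Ideal.Quotient.field _
  have : Module.Finite R N := Module.Finite.iff_fg.mpr hN
  have : Module.Finite (R ⧸ maximalIdeal R) (N ⧸ maximalIdeal R • (⊤ : Submodule R N)) :=
    Module.Finite.of_restrictScalars_finite R _ _
  have hrank : N.spanRank.toENat = length R (N ⧸ maximalIdeal R • (⊤ : Submodule R N)) := by
    rw [hN.spanRank_eq_spanFinrank, map_natCast, spanFinrank_eq_finrank_quotient N hN,
      ← length_eq_finrank,
      length_eq_of_surjective (Ideal.Quotient.mk_surjective (I := maximalIdeal R))]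
  have hsmul : length R (maximalIdeal R • (⊤ : Submodule R N) : Submodule R N) =
      length R ↥(maximalIdeal R • N) := by
    rw [(N.equivSubtypeMap _).length_eq, Submodule.map_smul'', Submodule.map_subtype_top]
  rw [hrank, ← hsmul, add_comm, ← length_eq_length_add_length_quotient]

theorem exists_mem_span_insert_eq_of_span_insert_eq {S T : Set M} (hS : S.Nonempty) {g : M}
    (h : Submodule.span R (insert g T) = Submodule.span R S) :
    ∃ s ∈ S, Submodule.span R (insert s T) = Submodule.span R S := by
  have hT : T ⊆ Submodule.span R S :=
    h ▸ (Set.subset_insert g T).trans Submodule.subset_span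
  suffices hg : ∃ s ∈ S, g ∈ Submodule.span R (insert s T) by
    obtain ⟨s, hs, hg⟩ := hg
    refine ⟨s, hs, le_antisymm ?_ ?_⟩
    · exact Submodule.span_le.mpr (Set.insert_subset (Submodule.subset_span hs) hT)
    · rw [← h, Submodule.span_le]
      exact Set.insert_subset hg ((Set.subset_insert s T).trans Submodule.subset_span)
  by_contra! hg
  have hSle : Submodule.span R S ≤ Submodule.span R T ⊔ maximalIdeal R • Submodule.span R {g} := by
    refine Submodule.span_le.mpr fun s hs ↦ ?_
    obtain ⟨b, t, ht, rfl⟩ := Submodule.mem_span_insert.mp (h ▸ Submodule.subset_span hs)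
    have hb : b ∈ maximalIdeal R := fun hb ↦ hg _ hs <| by
      rw [← Submodule.smul_mem_iff_of_isUnit _ hb, Submodule.mem_span_insert]
      exact ⟨1, -t, neg_mem ht, by module⟩
    exact add_mem (Submodule.mem_sup_right
      (Submodule.smul_mem_smul hb (Submodule.mem_span_singleton_self g)))
      (Submodule.mem_sup_left ht)
  have hgT : Submodule.span R {g} ≤ Submodule.span R T :=
    Submodule.le_of_le_smul_of_le_jacobson_bot (Submodule.fg_span_singleton g)
      (maximalIdeal_le_jacobson _)
      ((Submodule.span_mono (Set.singleton_subset_iff.mpr (Set.mem_insert g T))).trans (h ▸ hSle))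
  obtain ⟨s, hs⟩ := hS
  exact hg s hs (Submodule.span_mono (Set.subset_insert s T)
    ((Submodule.span_singleton_le_iff_mem _ _).mp hgT))

theorem exists_forall_mem_span_range_eq_of_span_range_eq {ι : Type*} [Finite ι] {S : Set M}
    (hS : S.Nonempty) {f : ι → M} (hf : Submodule.span R (Set.range f) = Submodule.span R S) :
    ∃ t : ι → M, (∀ i, t i ∈ S) ∧ Submodule.span R (Set.range t) = Submodule.span R S := by
  classical
  have := Fintype.ofFinite ι
  suffices h : ∀ J : Finset ι, ∃ t : ι → M, (∀ i ∈ J, t i ∈ S) ∧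
      Submodule.span R (Set.range t) = Submodule.span R S by
    simpa using h Finset.univ
  intro J
  induction J using Finset.induction_on with
  | empty => exact ⟨f, by simp, hf⟩
  | insert i J hi ih =>
    obtain ⟨t, htJ, ht⟩ := ih
    have hrange (s : M) : Set.range (Function.update t i s) = insert s (t '' {i}ᶜ) := by
      rw [← Set.insert_image_compl_eq_range _ i, Function.update_self]
      congr 1
      exact Set.image_congr fun j hj ↦ Function.update_of_ne hj s t
    rw [← Function.update_eq_self i t, hrange] at ht
    obtain ⟨s, hs, hspan⟩ := exists_mem_span_insert_eq_of_span_insert_eq hS ht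
    refine ⟨Function.update t i s, fun j hj ↦ ?_, by rw [hrange, hspan]⟩
    rcases eq_or_ne j i with rfl | hji
    · rwa [Function.update_self]
    · rw [Function.update_of_ne hji]
      exact htJ j (Finset.mem_of_mem_insert_of_ne hj hji)

end LocalRing

section Reduction

variable {A : Type*} [CommRing A] [IsLocalRing A] {I : Ideal A}

open scoped Pointwise in
theorem exists_sq_eq_span_mul_pair (hgen : (I ^ 2).minGen ≤ 2) :
    ∃ x ∈ I, ∃ y ∈ I, ∃ u ∈ I, ∃ v ∈ I, I ^ 2 = Ideal.span {x * y, u * v} := by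
  have hprod : I ^ 2 = Submodule.span A ((I : Set A) * (I : Set A)) := by
    rw [sq, Submodule.mul_def]
  obtain ⟨f, hf⟩ := exists_span_range_fin_eq_of_spanRank_le (Cardinal.toENat_le_natCast.mp hgen)
  obtain ⟨t, htI, ht⟩ := exists_forall_mem_span_range_eq_of_span_range_eq
    ⟨0, Set.mem_mul.mpr ⟨0, I.zero_mem, 0, I.zero_mem, mul_zero 0⟩⟩ (hf.trans hprod)
  obtain ⟨x, hx, y, hy, hxy⟩ := Set.mem_mul.mp (htI 0)
  obtain ⟨u, hu, v, hv, huv⟩ := Set.mem_mul.mp (htI 1)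
  refine ⟨x, hx, y, hy, u, hu, v, hv, ?_⟩
  rw [hprod, ← ht, hxy, huv]
  congr 1
  ext; simp [Fin.exists_fin_two, eq_comm]

theorem mul_mem_maximalIdeal_mul_sq {x y u v : A} (hx : x ∈ I) (hy : y ∈ I) (hu : u ∈ I)
    (hv : v ∈ I) (hspan : I ^ 2 = Ideal.span {x * y, u * v})
    (hxI : ¬ I ^ 2 ≤ Ideal.span {x} * I) (hvI : ¬ I ^ 2 ≤ Ideal.span {v} * I) :
    x * v ∈ maximalIdeal A * I ^ 2 := by
  have hxv : x * v ∈ I ^ 2 := sq I ▸ Ideal.mul_mem_mul hx hv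
  obtain ⟨a, b, hab⟩ := Ideal.mem_span_pair.mp (hspan ▸ hxv)
  have ha : a ∈ maximalIdeal A := fun ha ↦ hvI <| by
    rw [hspan, Ideal.span_le, Set.pair_subset_iff]
    refine ⟨?_, Ideal.mem_span_singleton_mul.mpr ⟨u, hu, mul_comm v u⟩⟩
    rw [SetLike.mem_coe, ← Ideal.unit_mul_mem_iff_mem _ ha]
    exact Ideal.mem_span_singleton_mul.mpr
      ⟨x - b * u, sub_mem hx (I.mul_mem_left b hu), by linear_combination -hab⟩
  have hb : b ∈ maximalIdeal A := fun hb ↦ hxI <| by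
    rw [hspan, Ideal.span_le, Set.pair_subset_iff]
    refine ⟨Ideal.mem_span_singleton_mul.mpr ⟨y, hy, rfl⟩, ?_⟩
    rw [SetLike.mem_coe, ← Ideal.unit_mul_mem_iff_mem _ hb]
    exact Ideal.mem_span_singleton_mul.mpr
      ⟨v - a * y, sub_mem hv (I.mul_mem_left a hy), by linear_combination -hab⟩
  rw [← hab, sq]
  exact add_mem (Ideal.mul_mem_mul ha (Ideal.mul_mem_mul hx hy))
    (Ideal.mul_mem_mul hb (Ideal.mul_mem_mul hu hv))

theorem exists_sq_eq_span_singleton_mul (hgen : (I ^ 2).minGen ≤ 2) :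
    ∃ w ∈ I, I ^ 2 = Ideal.span {w} * I := by
  suffices h : ∃ w ∈ I, I ^ 2 ≤ Ideal.span {w} * I by
    obtain ⟨w, hw, hle⟩ := h
    refine ⟨w, hw, hle.antisymm ?_⟩
    rw [sq]
    exact Ideal.mul_mono_left ((Ideal.span_singleton_le_iff_mem I).mpr hw)
  by_contra! hI
  obtain ⟨x, hx, y, hy, u, hu, v, hv, hspan⟩ := exists_sq_eq_span_mul_pair hgen
  have hfg : (I ^ 2).FG := hspan ▸ Submodule.fg_span (Set.toFinite _)
  have hxv := mul_mem_maximalIdeal_mul_sq hx hy hu hv hspan (hI x hx) (hI v hv)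
  have huy := mul_mem_maximalIdeal_mul_sq hu hv hx hy (by rw [hspan, Set.pair_comm]) (hI u hu)
    (hI y hy)
  have hmul {z : A} (hz : z ∈ I) : (x + u) * z ∈ Ideal.span {x + u} * I :=
    Ideal.mul_mem_mul (Ideal.mem_span_singleton_self _) hz
  refine hI (x + u) (add_mem hx hu) (Submodule.le_of_le_smul_of_le_jacobson_bot hfg
    (maximalIdeal_le_jacobson _) ?_)
  conv_lhs => rw [hspan]
  rw [Ideal.span_le, Set.pair_subset_iff]
  constructor
  · rw [show x * y = (x + u) * y + -(u * y) by ring]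
    exact Submodule.add_mem_sup (hmul hy) (neg_mem huy)
  · rw [show u * v = (x + u) * v + -(x * v) by ring]
    exact Submodule.add_mem_sup (hmul hv) (neg_mem hxv)

end Reduction

section Exactness

variable {A : Type*} [CommRing A] [IsLocalRing A]

theorem minGen_add_length_maximalIdeal_mul {I : Ideal A} (hI : I.FG) :
    I.minGen + length A ↥(maximalIdeal A * I) = length A I :=
  toENat_spanRank_add_length_maximalIdeal_smul hI

variable [IsArtinianRing A]

theorem minGen_le_length_quotient_span_singleton (I : Ideal A) {x : A}
    (hx : x ∈ maximalIdeal A) : I.minGen ≤ length A (A ⧸ Ideal.span {x}) := by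
  let f : A →ₗ[A] A := LinearMap.toSpanSingleton A A x
  have hmap : Submodule.map f I ≤ maximalIdeal A * I := by
    rintro _ ⟨a, ha, rfl⟩
    exact Ideal.mul_mem_mul_rev hx ha
  have hrange : f.range = Ideal.span {x} := LinearMap.range_toSpanSingleton x
  refine (ENat.add_le_add_iff_right (k := length A ↥(maximalIdeal A * I)) length_ne_top).mp ?_
  calc I.minGen + length A ↥(maximalIdeal A * I)
      = length A I := minGen_add_length_maximalIdeal_mul (IsNoetherian.noetherian I)
    _ ≤ length A (A ⧸ f.range) + length A (Submodule.map f I) :=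
      length_le_length_quotient_range_add_length_map f I
    _ ≤ length A (A ⧸ Ideal.span {x}) + length A ↥(maximalIdeal A * I) := by
      rw [hrange]
      gcongr
      exact length_le_of_injective (Submodule.inclusion hmap) (Submodule.inclusion_injective hmap)

theorem dilworthNumber_le_reesNumber : dilworthNumber A ≤ reesNumber A :=
  iSup₂_le fun I _ ↦ le_iInf₂ fun _ hx ↦ minGen_le_length_quotient_span_singleton I hx

theorem length_quotient_span_singleton_eq_minGen_maximalIdeal {w : A} (hw : w ≠ 0)
    (hsq : maximalIdeal A ^ 2 = Ideal.span {w} * maximalIdeal A) :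
    length A (A ⧸ Ideal.span {w}) = (maximalIdeal A).minGen := by
  have hone : (Ideal.span {w}).minGen = 1 := by
    rw [Ideal.minGen, (Submodule.fg_span_singleton w).spanRank_eq_spanFinrank,
      Submodule.spanFinrank_singleton hw, map_natCast, Nat.cast_one]
  have hresidue : length A (A ⧸ maximalIdeal A) = 1 :=
    length_eq_one_iff.mpr (isSimpleModule_iff_isCoatom.mpr (maximalIdeal.isMaximal A).out)
  refine ENat.add_right_injective_of_ne_top
    (n := 1 + length A ↥(maximalIdeal A ^ 2)) (by simp [length_ne_top]) ?_
  calc 1 + length A ↥(maximalIdeal A ^ 2) + length A (A ⧸ Ideal.span {w})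
      = length A (Ideal.span {w}) + length A (A ⧸ Ideal.span {w}) := by
        rw [← minGen_add_length_maximalIdeal_mul (Submodule.fg_span_singleton w), hone, hsq,
          mul_comm (Ideal.span {w})]
    _ = length A (maximalIdeal A) + length A (A ⧸ maximalIdeal A) := by
        rw [← length_eq_length_add_length_quotient, ← length_eq_length_add_length_quotient]
    _ = (maximalIdeal A).minGen + length A ↥(maximalIdeal A ^ 2) + 1 := by
        rw [hresidue, sq, minGen_add_length_maximalIdeal_mul (IsNoetherian.noetherian _)]
    _ = 1 + length A ↥(maximalIdeal A ^ 2) + (maximalIdeal A).minGen := by ring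

theorem isExactLocalRing_of_maximalIdeal_sq_eq {w : A} (hw : w ∈ maximalIdeal A) (hw0 : w ≠ 0)
    (hsq : maximalIdeal A ^ 2 = Ideal.span {w} * maximalIdeal A) : IsExactLocalRing A := by
  refine le_antisymm dilworthNumber_le_reesNumber ?_
  calc reesNumber A ≤ length A (A ⧸ Ideal.span {w}) := iInf₂_le w hw
    _ = (maximalIdeal A).minGen := length_quotient_span_singleton_eq_minGen_maximalIdeal hw0 hsq
    _ ≤ dilworthNumber A := le_iSup₂_of_le (maximalIdeal A) (le_refl (maximalIdeal A)) le_rfl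

theorem mainTheorem4_general (hA : ¬ IsField A) (hgen : (maximalIdeal A ^ 2).minGen ≤ 2) :
    IsExactLocalRing A := by
  obtain ⟨w, hw, hsq⟩ := exists_sq_eq_span_singleton_mul hgen
  rcases eq_or_ne w 0 with rfl | hw0
  · rw [Ideal.span_singleton_zero, Ideal.bot_mul] at hsq
    obtain ⟨z, hz, hz0⟩ := Submodule.exists_mem_ne_zero_of_ne_bot
      (mt isField_iff_maximalIdeal_eq.mpr hA)
    refine isExactLocalRing_of_maximalIdeal_sq_eq hz hz0 (hsq.trans (eq_bot_iff.mpr ?_).symm)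
    rw [← hsq, sq]
    exact Ideal.mul_mono_left ((Ideal.span_singleton_le_iff_mem _).mpr hz)
  · exact isExactLocalRing_of_maximalIdeal_sq_eq hw hw0 hsq

end Exactness

theorem IsAlmostStretched.not_isField {A : Type*} [CommRing A] [IsLocalRing A]
    (hA : IsAlmostStretched A) : ¬ IsField A := by
  intro hfield
  have hgen := hA.2
  rw [isField_iff_maximalIdeal_eq.mp hfield, Ideal.bot_pow two_ne_zero, Ideal.minGen,
    Submodule.spanRank_bot, map_zero] at hgen
  exact two_ne_zero hgen.symm

theorem mainTheorem4 {k A : Type*} [Field k] [IsAlgClosed k] [CharZero k]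
    [CommRing A] [IsLocalRing A] [Algebra k A]
    (hG : IsGorensteinLocalRing A) (hA : IsAlmostStretched A) :
    IsExactLocalRing A := by
  have := hA.1
  exact mainTheorem4_general hA.not_isField hA.2.le
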